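/- Let $K$ be a finitely generated free abelian group, let $A$ be a subgroup of $K$, and let $f$ be an automorphism of $K$ of finite order. Then the HNN-extension $$G=\langle K, t \mid t a t^{-1}=f(a),\ a\in A\rangle$$ of $K$ with stable letter $t$ and associated subgroups $A$ and $f(A)$, identified by the restriction $f|_A : A\to f(A)$ (that is, the quotient of the free product $K*\langle t\rangle$, with $\langle t\rangle$ infinite cyclic, by the normal closure of $\{t a t^{-1} f(a)^{-1} : a\in A\}$), is $\mathbb{Z}$-linear: there are a natural number $n$ and an injective group homomorphism $G\to GL_n(\mathbb{Z})$. -/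

import Mathlib

/-- A group `G` is linear over a commutative ring `R` (for `R = ℤ`: `G` is `ℤ`-linear) if it admits
a faithful representation into `GL_n(R)` for some `n`. -/
def IsLinearGroupOver (R : Type*) [CommRing R] (G : Type*) [Group G] : Prop :=
  ∃ (n : ℕ) (ρ : G →* Matrix.GeneralLinearGroup (Fin n) R), Function.Injective ρ

/-! An integral Gram matrix with 2 on the diagonal and entries at most -2 off it yields reflections
`r_x` that play ping-pong. If its rows span a finite-rank lattice, that lattice carries the
reflections and all permutations preserving the matrix. Let `K` act faithfully by such permutations,
let `τ` be one intertwining `k` with `f k`, and let `e`, `e'` have stabilizer `A`. Then `t ↦ τ r_e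
r_e'` respects the relations, because the image of `A` commutes with both reflections. By ping-pong,
a reduced word containing `t` or its inverse moves the constant function -1. The set used is a union
of copies of `K ⧸ A` and `K` indexed by `Bool` and the powers of `f`; finite order of `f` keeps the
rank finite. -/

/-- An integer kernel on `X` with finite-dimensional span which is `2` on the diagonal and at most
`-2` off the diagonal: the Gram matrix of a family of vectors in a finite-rank lattice whose
reflections generate a free product of groups of order two. -/
structure IsReflectionKernel {X : Type*} (b : X → X → ℤ) : Prop where
  self (x : X) : b x x = 2
  of_ne {x y : X} : x ≠ y → b x y ≤ -2
  fg : (Submodule.span ℤ (Set.range b)).FG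

/-! ### Reflections, permutations and chambers. -/

namespace IsReflectionKernel

variable {X : Type*} {b : X → X → ℤ}

/-- The permutation representation on integer-valued functions. -/
def permRep (X : Type*) : Equiv.Perm X →* ((X → ℤ) ≃ₗ[ℤ] (X → ℤ)) where
  toFun σ := LinearEquiv.funCongrLeft ℤ ℤ σ⁻¹
  map_one' := rfl
  map_mul' _ _ := rfl

theorem permRep_apply (σ : Equiv.Perm X) (F : X → ℤ) (x : X) :
    permRep X σ F x = F (σ⁻¹ x) := rfl

theorem permRep_apply_apply (σ : Equiv.Perm X) (F : X → ℤ) (x : X) :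
    permRep X σ F (σ x) = F x := by
  simp [permRep_apply]

/-- The reflection `F ↦ F - F x • b x`. -/
def refl (hb : IsReflectionKernel b) (x : X) : (X → ℤ) ≃ₗ[ℤ] (X → ℤ) :=
  Module.reflection (x := b x) (f := LinearMap.proj x) (hb.self x)

theorem refl_apply (hb : IsReflectionKernel b) (x : X) (F : X → ℤ) (y : X) :
    hb.refl x F y = F y - F x * b x y := by
  exact congrFun (Module.reflection_apply (f := LinearMap.proj x) F (hb.self x)) y

theorem refl_mul_self (hb : IsReflectionKernel b) (x : X) : hb.refl x * hb.refl x = 1 := by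
  ext F y
  simp only [LinearEquiv.mul_apply, refl_apply, LinearEquiv.coe_one, id_eq, hb.self]
  ring

theorem refl_inv (hb : IsReflectionKernel b) (x : X) : (hb.refl x)⁻¹ = hb.refl x :=
  inv_eq_of_mul_eq_one_left (hb.refl_mul_self x)

theorem permRep_kernel {σ : Equiv.Perm X} (hσ : ∀ x y, b (σ x) (σ y) = b x y) (x : X) :
    permRep X σ (b x) = b (σ x) := by
  ext y
  rw [permRep_apply, ← hσ]
  simp

theorem permRep_mul_refl (hb : IsReflectionKernel b) {σ : Equiv.Perm X}
    (hσ : ∀ x y, b (σ x) (σ y) = b x y) (x : X) :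
    permRep X σ * hb.refl x = hb.refl (σ x) * permRep X σ := by
  ext F y
  obtain ⟨z, rfl⟩ := σ.surjective y
  simp [LinearEquiv.mul_apply, refl_apply, permRep_apply, hσ]

/-- The chamber of functions that are positive at `x` and very negative elsewhere. -/
def chamber (x : X) : Set (X → ℤ) := {F | 0 < F x ∧ ∀ y, y ≠ x → F y ≤ -F x}

/-- Since `F y ≤ -F x < 0`, the new value at `y` is `-F y > 0`, and at `z` it is at most `F z + 2 *
F y`, where `F z ≤ F x ≤ -F y`. -/
theorem refl_mem_chamber (hb : IsReflectionKernel b) {x y : X} {F : X → ℤ} (hF : F ∈ chamber x)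
    (hxy : y ≠ x) : hb.refl y F ∈ chamber y := by
  have hy := hF.2 y hxy
  have h0 := hF.1
  refine ⟨?_, fun z hz => ?_⟩
  · rw [refl_apply, hb.self]; linarith
  · rw [refl_apply, refl_apply, hb.self]
    have hb2 := hb.of_ne hz.symm
    have hz' : F z ≤ F x := by
      by_cases h : z = x
      · rw [h]
      · linarith [hF.2 z h]
    nlinarith

/-- The constant -1 is the base point of the ping-pong: it lies in no chamber. -/
theorem refl_neg_one_mem_chamber (hb : IsReflectionKernel b) (y : X) :
    hb.refl y (fun _ => -1) ∈ chamber y := by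
  refine ⟨by simp [refl_apply, hb.self], fun z hz => ?_⟩
  have hb2 := hb.of_ne hz.symm
  simp only [refl_apply, hb.self]
  linarith

theorem permRep_mem_chamber (σ : Equiv.Perm X) {x : X} {F : X → ℤ} (hF : F ∈ chamber x) :
    permRep X σ F ∈ chamber (σ x) := by
  refine ⟨by simpa [permRep_apply_apply] using hF.1, fun y hy => ?_⟩
  obtain ⟨z, rfl⟩ := σ.surjective y
  simpa [permRep_apply_apply] using hF.2 z (fun h => hy (by rw [h]))

theorem neg_one_notMem_chamber (x : X) : (fun _ => -1 : X → ℤ) ∉ chamber x := fun h => by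
  have := h.1
  norm_num at this

variable (b) in
/-- The lattice of functions spanned by the constants and the rows of the kernel. -/
def lattice : Submodule ℤ (X → ℤ) := Submodule.span ℤ (insert (fun _ => -1) (Set.range b))

theorem lattice_fg (hb : IsReflectionKernel b) : (lattice b).FG := by
  rw [lattice, Submodule.span_insert]
  exact (Submodule.fg_span_singleton _).sup hb.fg

variable (b) in
theorem neg_one_mem_lattice : (fun _ => -1 : X → ℤ) ∈ lattice b :=
  Submodule.subset_span (Set.mem_insert _ _)

variable (b) in
theorem kernel_mem_lattice (x : X) : b x ∈ lattice b :=
  Submodule.subset_span (Set.mem_insert_of_mem _ ⟨x, rfl⟩)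

theorem permRep_mem_lattice {σ : Equiv.Perm X} (hσ : ∀ x y, b (σ x) (σ y) = b x y) {F : X → ℤ}
    (hF : F ∈ lattice b) : permRep X σ F ∈ lattice b := by
  refine (Submodule.span_le (p := (lattice b).comap (permRep X σ).toLinearMap)).2 ?_ hF
  rintro _ (rfl | ⟨x, rfl⟩)
  · exact neg_one_mem_lattice b
  · change permRep X σ (b x) ∈ lattice b
    rw [permRep_kernel hσ]
    exact kernel_mem_lattice b _

theorem refl_mem_lattice (hb : IsReflectionKernel b) (x : X) {F : X → ℤ}
    (hF : F ∈ lattice b) : hb.refl x F ∈ lattice b := by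
  have : hb.refl x F = F - F x • b x := by ext y; simp [refl_apply]
  rw [this]
  exact sub_mem hF (Submodule.smul_mem _ _ (kernel_mem_lattice b x))

end IsReflectionKernel

/-- A group acting faithfully by linear maps on a finitely generated lattice of integer-valued
functions is `ℤ`-linear. -/
theorem isLinearGroupOver_of_lattice {G X : Type*} [Group G] (Φ : G →* ((X → ℤ) ≃ₗ[ℤ] (X → ℤ)))
    (V : Submodule ℤ (X → ℤ)) (hV : V.FG) (hΦ : ∀ g, ∀ F ∈ V, Φ g F ∈ V)
    (hinj : ∀ g, (∀ F ∈ V, Φ g F = F) → g = 1) : IsLinearGroupOver ℤ G := by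
  have : Module.Finite ℤ V := Module.Finite.iff_fg.2 hV
  have : Module.Free ℤ V := inferInstance
  let ρ : G →* Module.End ℤ V :=
    { toFun g := (Φ g).toLinearMap.restrict (hΦ g)
      map_one' := by ext; simp [LinearMap.restrict_apply]
      map_mul' g h := by ext; simp [LinearMap.restrict_apply] }
  let e : Module.End ℤ V →* Matrix (Fin (Module.finrank ℤ V)) (Fin (Module.finrank ℤ V)) ℤ :=
    (LinearMap.toMatrixAlgEquiv (Module.finBasis ℤ V)).toMulEquiv.toMonoidHom
  have he : Function.Injective e := (LinearMap.toMatrixAlgEquiv (Module.finBasis ℤ V)).injective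
  refine ⟨_, (e.comp ρ).toHomUnits, (injective_iff_map_eq_one _).2 fun g hg => hinj g ?_⟩
  intro F hF
  have h1 : e (ρ g) = e 1 := by
    rw [map_one]
    exact congrArg Units.val hg
  have h2 := LinearMap.congr_fun (he h1) ⟨F, hF⟩
  exact congrArg Subtype.val h2

/-! ### Ping-pong for HNN extensions. -/

namespace HNNExtension

open IsReflectionKernel

/-- Every element of an HNN extension is represented by a reduced word. -/
theorem exists_reducedWord_prod_eq {K : Type*} [Group K] {A B : Subgroup K} (φ : A ≃* B)
    (g : HNNExtension K A B φ) :
    ∃ w : NormalWord.ReducedWord K A B, w.prod φ = g := by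
  obtain ⟨d⟩ := NormalWord.TransversalPair.nonempty K A B
  exact ⟨(g • (NormalWord.empty : NormalWord d)).toReducedWord, by
    rw [NormalWord.prod_smul, NormalWord.prod_empty, mul_one]⟩

variable {K X : Type*} [Group K] {A B : Subgroup K} {φ : A ≃* B} {b : X → X → ℤ}

/-- The representation of an HNN extension in which the base acts by permutations and the stable
letter acts as a permutation times a product of two reflections. -/
noncomputable def reflectionRep (hb : IsReflectionKernel b) (a : K →* Equiv.Perm X)
    (τ : Equiv.Perm X) (hτa : ∀ k : A, τ * a k = a (φ k) * τ)
    (hab : ∀ k x y, b (a k x) (a k y) = b x y) (e e' : X)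
    (he : ∀ k, a k e = e ↔ k ∈ A) (he' : ∀ k, a k e' = e' ↔ k ∈ A) :
    HNNExtension K A B φ →* ((X → ℤ) ≃ₗ[ℤ] (X → ℤ)) :=
  lift ((permRep X).comp a) (permRep X τ * hb.refl e * hb.refl e') fun k => by
    have h1 := hb.permRep_mul_refl (hab k) e
    have h2 := hb.permRep_mul_refl (hab k) e'
    rw [(he k).2 k.2] at h1
    rw [(he' k).2 k.2] at h2
    simp only [MonoidHom.comp_apply]
    rw [mul_assoc, ← h2, ← mul_assoc, mul_assoc (permRep X τ), ← h1, ← mul_assoc, ← map_mul,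
      hτa, map_mul]
    simp only [mul_assoc]

/-- Ping-pong fails only when a chamber meets its own reflection. For opposite exponents the
stabilizer conditions make this a pinch, absent from reduced words; for equal exponents `hee'`
excludes it. -/
theorem isLinearGroupOver_int_of_isReflectionKernel (hb : IsReflectionKernel b)
    (a : K →* Equiv.Perm X) (ha : Function.Injective a) (τ : Equiv.Perm X)
    (hτa : ∀ k : A, τ * a k = a (φ k) * τ)
    (hab : ∀ k x y, b (a k x) (a k y) = b x y) (hτb : ∀ x y, b (τ x) (τ y) = b x y) (e e' : X)
    (he : ∀ k, a k e = e ↔ k ∈ A) (he' : ∀ k, a k e' = e' ↔ k ∈ A)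
    (hτe : ∀ k, a k (τ e) = τ e → k ∈ B) (hne : e ≠ e') (hee' : ∀ k, a k (τ e) ≠ e') :
    IsLinearGroupOver ℤ (HNNExtension K A B φ) := by
  set Φ := reflectionRep hb a τ hτa hab e e' he he' with hΦ
  have hΦof (k : K) : Φ (of k) = permRep X (a k) := by simp [hΦ, reflectionRep]
  have hΦt : Φ t = permRep X τ * hb.refl e * hb.refl e' := by simp [hΦ, reflectionRep]
  have hΦt' : Φ t⁻¹ = hb.refl e' * hb.refl e * permRep X τ⁻¹ := by
    rw [map_inv, hΦt, mul_inv_rev, mul_inv_rev, refl_inv, refl_inv, map_inv, mul_assoc]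
  have hτb' (x y) : b (τ⁻¹ x) (τ⁻¹ y) = b x y := by rw [← hτb]; simp
  have hstable (g) : (∀ F ∈ lattice b, Φ g F ∈ lattice b) ∧
      (∀ F ∈ lattice b, Φ g⁻¹ F ∈ lattice b) := by
    induction g using HNNExtension.induction_on with
    | of k =>
      rw [← map_inv, hΦof, hΦof]
      exact ⟨fun F => permRep_mem_lattice (hab k), fun F => permRep_mem_lattice (hab k⁻¹)⟩
    | t =>
      rw [hΦt, hΦt']
      exact ⟨fun F hF => permRep_mem_lattice hτb
          (hb.refl_mem_lattice e (hb.refl_mem_lattice e' hF)),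
        fun F hF => hb.refl_mem_lattice e' (hb.refl_mem_lattice e
          (permRep_mem_lattice hτb' hF))⟩
    | mul x y hx hy =>
      rw [mul_inv_rev, map_mul, map_mul]
      exact ⟨fun F hF => hx.1 _ (hy.1 _ hF), fun F hF => hy.2 _ (hx.2 _ hF)⟩
    | inv x hx => exact ⟨hx.2, by simpa using hx.1⟩
  -- `root u` indexes the chamber where reduced words beginning with `t ^ u` send -1.
  let root : ℤˣ → X := fun u => if u = 1 then τ e else e'
  have hpos (F : X → ℤ) (k : K)
      (hF : F = (fun _ => -1) ∨ ∃ u : ℤˣ, F ∈ chamber (root u) ∧ (k ∈ A → u = 1)) :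
      Φ (t * of k) F ∈ chamber (τ e) := by
    rw [map_mul, hΦt, hΦof]
    refine permRep_mem_chamber τ (hb.refl_mem_chamber (x := e') ?_ ?_)
    · rcases hF with rfl | ⟨u, hu, hk⟩
      · exact hb.refl_neg_one_mem_chamber e'
      · refine hb.refl_mem_chamber (permRep_mem_chamber (a k) hu) ?_
        rcases Int.units_eq_one_or u with rfl | rfl
        · exact (hee' k).symm
        · exact fun h => absurd (hk ((he' k).1 h.symm)) (by decide)
    · exact hne
  have hneg (F : X → ℤ) (k : K)
      (hF : F = (fun _ => -1) ∨ ∃ u : ℤˣ, F ∈ chamber (root u) ∧ (k ∈ B → u = -1)) :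
      Φ (t⁻¹ * of k) F ∈ chamber e' := by
    rw [map_mul, hΦt', hΦof]
    refine hb.refl_mem_chamber (x := e) ?_ ?_
    · rcases hF with rfl | ⟨u, hu, hk⟩
      · exact hb.refl_neg_one_mem_chamber e
      · refine hb.refl_mem_chamber (permRep_mem_chamber τ⁻¹ (permRep_mem_chamber (a k) hu)) ?_
        rw [Ne, Equiv.Perm.eq_inv_iff_eq]
        rcases Int.units_eq_one_or u with rfl | rfl
        · exact fun h => absurd (hk (hτe k h.symm)) (by decide)
        · intro h
          have h : τ e = a k e' := h
          apply hee' k⁻¹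
          rw [h, map_inv, Equiv.Perm.inv_eq_iff_eq]
    · exact hne.symm
  have hword (l : List (ℤˣ × K)) (p : ℤˣ × K)
      (hl : (p :: l).IsChain (fun p q => p.2 ∈ toSubgroup A B p.1 → p.1 = q.1)) :
      Φ ((p :: l).map fun p => (t ^ (p.1 : ℤ) * of p.2 : HNNExtension K A B φ)).prod (fun _ => -1)
        ∈ chamber (root p.1) := by
    induction l generalizing p with
    | nil =>
      obtain ⟨u, k⟩ := p
      rcases Int.units_eq_one_or u with rfl | rfl
      · simpa [root] using hpos _ k (Or.inl rfl)
      · simpa [root] using hneg _ k (Or.inl rfl)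
    | cons q l ih =>
      obtain ⟨hpq, hl⟩ := List.isChain_cons_cons.1 hl
      have := ih q hl
      obtain ⟨u, k⟩ := p
      rw [List.map_cons, List.prod_cons, map_mul, LinearEquiv.mul_apply]
      rcases Int.units_eq_one_or u with rfl | rfl
      · simpa [root] using hpos _ k (Or.inr ⟨q.1, this, fun h => (hpq h).symm⟩)
      · simpa [root] using hneg _ k (Or.inr ⟨q.1, this, fun h => (hpq h).symm⟩)
  refine isLinearGroupOver_of_lattice Φ (lattice b) hb.lattice_fg (fun g => (hstable g).1) ?_
  intro g hg
  obtain ⟨⟨k, l, hl⟩, rfl⟩ := exists_reducedWord_prod_eq φ g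
  cases l with
  | nil =>
    simp only [NormalWord.ReducedWord.prod, List.map_nil, List.prod_nil, mul_one] at hg ⊢
    suffices k = 1 by rw [this, map_one]
    refine (injective_iff_map_eq_one a).1 ha k (Equiv.ext fun x => ?_)
    by_contra hne
    have h1 := congrFun (hg (b x) (kernel_mem_lattice b x)) x
    rw [hΦof, permRep_kernel (hab k), hb.self] at h1
    have h2 := hb.of_ne hne
    simp only [Equiv.Perm.coe_one, id_eq] at h2
    omega
  | cons p l =>
    have h1 := hg _ (neg_one_mem_lattice b)
    have h2 := permRep_mem_chamber (a k) (hword l p hl)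
    rw [← hΦof, ← LinearEquiv.mul_apply, ← map_mul] at h2
    exact absurd (h1 ▸ h2) (neg_one_notMem_chamber _)

end HNNExtension

/-! ### Construction of finite-rank kernels. -/

namespace IsReflectionKernel

variable {X Y : Type*} {b : X → X → ℤ}

theorem of_forall_mem {N : Submodule ℤ (X → ℤ)} (hself : ∀ x, b x x = 2)
    (hne : ∀ x y, x ≠ y → b x y ≤ -2) (hN : N.FG) (hb : ∀ x, b x ∈ N) :
    IsReflectionKernel b :=
  ⟨hself, fun {_ _} => hne _ _, hN.of_le (Submodule.span_le.2 (by rintro _ ⟨x, rfl⟩; exact hb x))⟩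

theorem comap (hb : IsReflectionKernel b) {g : Y → X} (hg : Function.Injective g) :
    IsReflectionKernel (fun x y => b (g x) (g y)) :=
  of_forall_mem (N := (Submodule.span ℤ (Set.range b)).map (LinearMap.funLeft ℤ ℤ g))
    (fun _ => hb.self _) (fun _ _ h => hb.of_ne (hg.ne h)) (hb.fg.map _)
    fun x => ⟨b (g x), Submodule.subset_span ⟨_, rfl⟩, rfl⟩

open Classical in
/-- The kernel on a disjoint union of copies of `X`. -/
noncomputable def prodKernel (ι : Type*) (b : X → X → ℤ) (p q : ι × X) : ℤ :=
  if p.1 = q.1 then b p.2 q.2 else -2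

open Classical in
theorem prod {ι : Type*} [Finite ι] (hb : IsReflectionKernel b) : IsReflectionKernel (prodKernel ι b) := by
  let T (i : ι) : (X → ℤ) →ₗ[ℤ] (ι × X → ℤ) :=
    { toFun F p := if i = p.1 then F p.2 else 0
      map_add' F F' := by ext p; by_cases h : i = p.1 <;> simp [h]
      map_smul' c F := by ext p; by_cases h : i = p.1 <;> simp [h] }
  let S := Submodule.span ℤ (insert (fun _ => 1) (Set.range b))
  have hS : S.FG := by
    simp only [S, Submodule.span_insert]
    exact (Submodule.fg_span_singleton _).sup hb.fg
  have h1 : (fun _ => 1) ∈ S := Submodule.subset_span (Set.mem_insert _ _)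
  have hbS (x) : b x ∈ S := Submodule.subset_span (Set.mem_insert_of_mem _ ⟨x, rfl⟩)
  refine of_forall_mem (N := Submodule.span ℤ {fun _ => 1} ⊔ ⨆ i, S.map (T i))
    (fun p => by simp [prodKernel, hb.self]) ?_
    ((Submodule.fg_span_singleton _).sup (Submodule.fg_iSup _ fun i => hS.map _)) ?_
  · intro p q hpq
    simp only [prodKernel]
    split_ifs with h
    · exact hb.of_ne fun h' => hpq (Prod.ext h h')
    · rfl
  · rintro ⟨i, x⟩
    -- A row is -2 everywhere, corrected on the `i`-th copy only.
    have : prodKernel ι b (i, x) = (-2 : ℤ) • (fun _ => 1) + T i (b x + (2 : ℤ) • fun _ => 1) := by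
      ext p
      by_cases h : i = p.1 <;> simp [T, prodKernel, h]
    rw [this]
    refine Submodule.add_mem_sup (Submodule.smul_mem _ _ (Submodule.mem_span_singleton_self _))
      (Submodule.mem_iSup_of_mem i ⟨_, add_mem (hbS x) (Submodule.smul_mem _ _ h1), rfl⟩)

/-- The kernel on the disjoint union of `X` and `Y`. -/
def sumKernel (b : X → X → ℤ) (c : Y → Y → ℤ) : X ⊕ Y → X ⊕ Y → ℤ
  | .inl x, .inl y => b x y
  | .inr x, .inr y => c x y
  | _, _ => -2

theorem sum (hb : IsReflectionKernel b) {c : Y → Y → ℤ} (hc : IsReflectionKernel c) :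
    IsReflectionKernel (sumKernel b c) := by
  let Tl : (X → ℤ) →ₗ[ℤ] (X ⊕ Y → ℤ) :=
    { toFun F := Sum.elim F 0
      map_add' F F' := by ext (p | p) <;> simp
      map_smul' c F := by ext (p | p) <;> simp }
  let Tr : (Y → ℤ) →ₗ[ℤ] (X ⊕ Y → ℤ) :=
    { toFun F := Sum.elim 0 F
      map_add' F F' := by ext (p | p) <;> simp
      map_smul' c F := by ext (p | p) <;> simp }
  refine of_forall_mem
    (N := (Submodule.span ℤ {Tr fun _ => 1} ⊔ (Submodule.span ℤ (Set.range b)).map Tl) ⊔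
      (Submodule.span ℤ {Tl fun _ => 1} ⊔ (Submodule.span ℤ (Set.range c)).map Tr))
    ?_ ?_ (((Submodule.fg_span_singleton _).sup (hb.fg.map _)).sup
      ((Submodule.fg_span_singleton _).sup (hc.fg.map _))) ?_
  · rintro (x | x)
    · exact hb.self x
    · exact hc.self x
  · rintro (x | x) (y | y) h
    · exact hb.of_ne fun h' => h (by rw [h'])
    · exact le_rfl
    · exact le_rfl
    · exact hc.of_ne fun h' => h (by rw [h'])
  · rintro (x | x)
    · have : sumKernel b c (.inl x) = (-2 : ℤ) • (Tr fun _ => 1) + Tl (b x) := by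
        ext (p | p) <;> simp [Tl, Tr, sumKernel]
      rw [this]
      exact Submodule.mem_sup_left (Submodule.add_mem_sup
        (Submodule.smul_mem _ _ (Submodule.mem_span_singleton_self _))
        ⟨_, Submodule.subset_span ⟨_, rfl⟩, rfl⟩)
    · have : sumKernel b c (.inr x) = (-2 : ℤ) • (Tl fun _ => 1) + Tr (c x) := by
        ext (p | p) <;> simp [Tl, Tr, sumKernel]
      rw [this]
      exact Submodule.mem_sup_right (Submodule.add_mem_sup
        (Submodule.smul_mem _ _ (Submodule.mem_span_singleton_self _))
        ⟨_, Submodule.subset_span ⟨_, rfl⟩, rfl⟩)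

open Classical in
/-- The kernel of a free abelian group of finite rank times a finite set. -/
theorem free_prod_finite (n D : Type*) [Fintype n] [Finite D] :
    IsReflectionKernel (fun x y : (n → ℤ) × D =>
      (if x.2 = y.2 then 2 else -2) - 4 * ∑ i, (x.1 i - y.1 i) ^ 2) := by
  have := Fintype.ofFinite D
  let s : Set ((n → ℤ) × D → ℤ) := (Set.range fun (d : D) y => if d = y.2 then 1 else 0) ∪
    ((Set.range fun (i : n) y => y.1 i) ∪ {fun _ => 1, fun y => ∑ i, y.1 i ^ 2})
  have hs : s.Finite := (Set.finite_range _).union ((Set.finite_range _).union (Set.toFinite _))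
  refine of_forall_mem (N := Submodule.span ℤ s) (by simp) ?_ (Submodule.fg_span hs) ?_
  · intro x y hxy
    by_cases h : x.1 = y.1
    · have : x.2 ≠ y.2 := fun h' => hxy (Prod.ext h h')
      simp [h, this]
    -- The factor 4 suffices: an integral square is at least 1, and `2 - 4 = -2`.
    · obtain ⟨j, hj⟩ := Function.ne_iff.1 h
      have h1 : (x.1 j - y.1 j) ^ 2 ≤ ∑ i, (x.1 i - y.1 i) ^ 2 :=
        Finset.single_le_sum (f := fun i => (x.1 i - y.1 i) ^ 2) (fun i _ => sq_nonneg _)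
          (Finset.mem_univ j)
      have h2 : 0 < (x.1 j - y.1 j) ^ 2 := by have := sub_ne_zero.2 hj; positivity
      split_ifs <;> linarith
  · intro x
    -- Expanding the squares gives finite rank.
    have : (fun y : (n → ℤ) × D =>
        ((if x.2 = y.2 then 2 else -2) - 4 * ∑ i, (x.1 i - y.1 i) ^ 2 : ℤ)) =
        (4 : ℤ) • (fun y => if x.2 = y.2 then 1 else 0) + (∑ i, (8 * x.1 i) • fun y => y.1 i) +
          (-2 - 4 * ∑ i, x.1 i ^ 2) • (fun _ => 1) + (-4 : ℤ) • fun y => ∑ i, y.1 i ^ 2 := by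
      ext y
      simp only [sub_sq, Finset.sum_add_distrib, Finset.sum_sub_distrib, Pi.add_apply,
        Pi.smul_apply, Finset.sum_apply, smul_eq_mul, mul_assoc, ← Finset.mul_sum]
      split_ifs <;> ring
    rw [this]
    refine add_mem (add_mem (add_mem ?_ (sum_mem fun i _ => ?_)) ?_) ?_ <;>
      refine Submodule.smul_mem _ _ (Submodule.subset_span ?_)
    · exact Or.inl ⟨_, rfl⟩
    · exact Or.inr (Or.inl ⟨i, rfl⟩)
    · exact Or.inr (Or.inr (Or.inl rfl))
    · exact Or.inr (Or.inr (Or.inr rfl))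

/-- A finitely generated abelian group has a translation-invariant reflection kernel. -/
theorem exists_of_fg (C : Type*) [CommGroup C] [Group.FG C] :
    ∃ b : C → C → ℤ, IsReflectionKernel b ∧ ∀ c x y, b (c * x) (c * y) = b x y := by
  classical
  obtain ⟨n, ι, _, p, hp, e, ⟨g⟩⟩ := AddCommGroup.equiv_free_prod_directSum_zmod (Additive C)
  have (i : ι) : NeZero (p i ^ e i) := ⟨pow_ne_zero _ (hp i).ne_zero⟩
  have : Finite (DirectSum ι fun i => ZMod (p i ^ e i)) :=
    Finite.of_injective (fun x i => x i) DFunLike.coe_injective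
  let g' (c : C) := (((g (Additive.ofMul c)).1 : Fin n → ℤ), (g (Additive.ofMul c)).2)
  have hmul (c x : C) : g' (c * x) = g' c + g' x := by
    simp only [g', ofMul_mul, map_add, Prod.fst_add, Prod.snd_add, Prod.mk_add_mk, Finsupp.coe_add]
  have hg' : Function.Injective g' := fun x y h => by
    have h1 := (Prod.ext_iff.1 h).1
    have h2 := (Prod.ext_iff.1 h).2
    exact Additive.ofMul.injective (g.injective (Prod.ext (DFunLike.coe_injective h1) h2))
  refine ⟨_, (free_prod_finite (Fin n) (DirectSum ι fun i => ZMod (p i ^ e i))).comap hg',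
    fun c x y => ?_⟩
  simp only [hmul, Prod.fst_add, Prod.snd_add, Pi.add_apply, add_sub_add_left_eq_sub,
    add_right_inj]
  split_ifs <;> rfl

end IsReflectionKernel

/-! ### The twisted permutation action. -/

theorem QuotientGroup.smul_one_eq_one_iff {K : Type*} [CommGroup K] (A : Subgroup K) (k : K) :
    k • (1 : K ⧸ A) = 1 ↔ k ∈ A := by
  rw [← QuotientGroup.eq_one_iff, ← QuotientGroup.mk_one, MulAction.Quotient.smul_mk, smul_eq_mul,
    mul_one]

namespace HNNExtension

variable {K : Type*} [Group K]

/-- The action of a group on a product of copies of a set, twisted in each copy by an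
automorphism. -/
def twistedPerm (I Y : Type*) [MulAction K Y] (j : I → MulAut K) :
    K →* Equiv.Perm (I × Y) where
  toFun k :=
    { toFun p := (p.1, j p.1 k • p.2)
      invFun p := (p.1, j p.1 k⁻¹ • p.2)
      left_inv p := by simp
      right_inv p := by simp }
  map_one' := by ext p <;> simp
  map_mul' k l := by ext p <;> simp [mul_smul]

theorem twistedPerm_apply {I Y : Type*} [MulAction K Y] (j : I → MulAut K) (k : K) (p : I × Y) :
    twistedPerm I Y j k p = (p.1, j p.1 k • p.2) := rfl

end HNNExtension

open IsReflectionKernel HNNExtension in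
theorem mainTheorem5 {K : Type*} [CommGroup K] [Group.FG K] [Module.Free ℤ (Additive K)]
    (A : Subgroup K) (f : MulAut K) (hf : IsOfFinOrder f) :
    IsLinearGroupOver ℤ (HNNExtension K A (A.map (f : K →* K)) (f.subgroupMap A)) := by
  have : Finite (Subgroup.zpowers f) := finite_zpowers.2 hf
  obtain ⟨b₁, hb₁, hb₁K⟩ := exists_of_fg (K ⧸ A)
  obtain ⟨b₂, hb₂, hb₂K⟩ := exists_of_fg K
  have hc (k : K) (x y) : sumKernel b₁ b₂ (k • x) (k • y) = sumKernel b₁ b₂ x y := by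
    rcases x with x | x <;> rcases y with y | y
    · exact hb₁K k x y
    · rfl
    · rfl
    · exact hb₂K k x y
  let F : Subgroup.zpowers f := ⟨f, Subgroup.mem_zpowers f⟩
  -- Twisting copy `h` by `h⁻¹` makes the shift `h ↦ f * h` intertwine `k` with `f k`. `K ⧸ A`
  -- supplies the stabilizer `A`, `K` faithfulness, and `Bool` separates the orbits of `τ e` and
  -- `e'`.
  let a := twistedPerm (Bool × Subgroup.zpowers f) ((K ⧸ A) ⊕ K) fun i => (i.2⁻¹ : MulAut K)
  let τ : Equiv.Perm ((Bool × Subgroup.zpowers f) × ((K ⧸ A) ⊕ K)) :=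
    ((Equiv.refl Bool).prodCongr (Equiv.mulLeft F)).prodCongr (Equiv.refl _)
  have hτ (p) : τ p = ((p.1.1, F * p.1.2), p.2) := rfl
  have hstab (k : K) (i : Bool) : a k ((i, 1), .inl 1) = ((i, 1), .inl 1) ↔ k ∈ A := by
    simp [a, twistedPerm_apply, QuotientGroup.smul_one_eq_one_iff]
  refine isLinearGroupOver_int_of_isReflectionKernel
    ((hb₁.sum hb₂).prod (ι := Bool × Subgroup.zpowers f)) a ?_ τ ?_ ?_ ?_
    ((false, 1), .inl 1) ((true, 1), .inl 1)
    (fun k => hstab k _) (fun k => hstab k _) ?_ ?_ ?_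
  · intro k l h
    have := congrArg Prod.snd (Equiv.congr_fun h ((false, 1), .inr 1))
    simpa [a, twistedPerm_apply] using this
  · intro k
    ext p : 1
    simp [a, twistedPerm_apply, hτ, F]
  · intro k x y
    by_cases h : x.1 = y.1 <;> simp [prodKernel, a, twistedPerm_apply, h, hc]
  · intro x y
    have h : (τ x).1 = (τ y).1 ↔ x.1 = y.1 := by simp [hτ, Prod.ext_iff]
    by_cases hxy : x.1 = y.1
    · rw [prodKernel, prodKernel, if_pos hxy, if_pos (h.2 hxy)]; rfl
    · rw [prodKernel, prodKernel, if_neg hxy, if_neg (mt h.1 hxy)]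
  · intro k h
    have h' : f⁻¹ k ∈ A := by
      simpa [hτ, a, F, twistedPerm_apply, QuotientGroup.smul_one_eq_one_iff] using h
    exact ⟨_, h', MulAut.apply_inv_self _ f k⟩
  · simp
  · intro k h
    simp [a, hτ, twistedPerm_apply] at h
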